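/- Let $H=\{(t,v)\in\mathbb R\times\mathbb R^3 : t^2-|v|^2=1,\ t>0\}$ be hyperbolic $3$-space (the upper sheet of the two-sheeted hyperboloid in Minkowski space), with hyperbolic distance $d$, given by $\cosh d\big((t,v),(s,w)\big)=ts-v\cdot w$, and with its Riemannian volume $\mathrm dx$. For $\rho\ge 0$ let $$K_\rho(x,y)=\frac{\sin(\rho\, d(x,y))}{\rho\,\sinh d(x,y)},$$ extended by its limits at $\rho=0$ (where it is $d(x,y)/\sinh d(x,y)$) and at $d(x,y)=0$ (where it is $1$). For labels $\rho_{ij}\ge 0$, $1\le i<j\le 4$, of the edges of a tetrahedron with vertices $1,2,3,4$, and for a point $x_1\in H$, let $$I_6=\int_{H^3}\mathrm dx_2\,\mathrm dx_3\,\mathrm dx_4\; \prod_{1\le i<j\le 4}K_{\rho_{ij}}(x_i,x_j).$$ Then there is a constant $K$, independent of the labels, of the point $x_1$ and of the triangle, such that for all labels $\rho_{ij}\ge 0$, all $x_1\in H$ and every triangle $\{i,j,k\}$, $1\le i<j<k\le 4$, whose three labels $\rho_{ij},\rho_{ik},\rho_{jk}$ are nonzero, the integral $I_6$ converges absolutely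 and $$|I_6|\le\frac{K}{\rho_{ij}\,\rho_{ik}\,\rho_{jk}};$$ in particular $I_6\le K/(\rho_{ij}\rho_{ik}\rho_{jk})$. -/

import Mathlib

open MeasureTheory

noncomputable section

/-- Hyperbolic 3-space `H`: the upper sheet `t² - |v|² = 1`, `t > 0` of the two-sheeted
hyperboloid in Minkowski space `ℝ × ℝ³`. -/
def HypSpace : Type :=
  {p : ℝ × EuclideanSpace ℝ (Fin 3) // p.1 ^ 2 - ‖p.2‖ ^ 2 = 1 ∧ 0 < p.1}

namespace HypSpace

/-- The Borel σ-algebra inherited from Minkowski space. -/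
instance : MeasurableSpace HypSpace :=
  inferInstanceAs (MeasurableSpace
    {p : ℝ × EuclideanSpace ℝ (Fin 3) // p.1 ^ 2 - ‖p.2‖ ^ 2 = 1 ∧ 0 < p.1})

/-- The time coordinate of a point of `H`. -/
def time (x : HypSpace) : ℝ := x.1.1

/-- The spatial part of a point of `H`. -/
def space (x : HypSpace) : EuclideanSpace ℝ (Fin 3) := x.1.2

/-- The hyperbolic distance: `cosh d(x, y)` is the Minkowski product `x₀ y₀ - ⟨v, w⟩`. -/
def hdist (x y : HypSpace) : ℝ :=
  Real.arcosh (x.time * y.time - inner ℝ x.space y.space)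

/-- The global chart `v ↦ (√(1 + |v|²), v)` of `H`. -/
def chart (v : EuclideanSpace ℝ (Fin 3)) : HypSpace :=
  ⟨(√(1 + ‖v‖ ^ 2), v), by
    constructor
    · rw [Real.sq_sqrt (by positivity)]; ring
    · exact Real.sqrt_pos.mpr (by positivity)⟩

theorem measurable_chart : Measurable chart := by
  refine Measurable.subtype_mk ?_
  fun_prop

/-- The hyperbolic volume `dx`. In the chart above the metric induced by the Minkowski form has
matrix `1 - v vᵀ / (1 + |v|²)`, whose determinant is `1 / (1 + |v|²)`; so the Riemannian volume
is `dv / √(1 + |v|²)`. In geodesic polar coordinates this is `sinh² r dr dΩ`. -/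
def vol : Measure HypSpace :=
  Measure.map chart
    ((volume : Measure (EuclideanSpace ℝ (Fin 3))).withDensity
      fun v => ENNReal.ofReal (1 / √(1 + ‖v‖ ^ 2)))

/-- The projector kernel `K_ρ(x, y) = sin (ρ d) / (ρ sinh d)`, `d = d(x, y)`, continued by its
limits `d / sinh d` at `ρ = 0` and `1` at `d = 0`. -/
def kernel (ρ : ℝ) (x y : HypSpace) : ℝ :=
  if hdist x y = 0 then 1
  else if ρ = 0 then hdist x y / Real.sinh (hdist x y)
  else Real.sin (ρ * hdist x y) / (ρ * Real.sinh (hdist x y))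

end HypSpace

/-- The integrand of the tetrahedron amplitude. The vertices `1, 2, 3, 4` are numbered
`0, 1, 2, 3`; the edge joining the vertices `i < j` has the label `ρ i j`. The vertex `x₁` is
fixed and `p = (x₂, x₃, x₄)`. -/
def tetraIntegrand (ρ : Fin 4 → Fin 4 → ℝ) (x₁ : HypSpace)
    (p : HypSpace × HypSpace × HypSpace) : ℝ :=
  HypSpace.kernel (ρ 0 1) x₁ p.1 * HypSpace.kernel (ρ 0 2) x₁ p.2.1 *
    HypSpace.kernel (ρ 0 3) x₁ p.2.2 * HypSpace.kernel (ρ 1 2) p.1 p.2.1 *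
    HypSpace.kernel (ρ 1 3) p.1 p.2.2 * HypSpace.kernel (ρ 2 3) p.2.1 p.2.2

/-- The product volume `dx₂ dx₃ dx₄` on `H³`. -/
def tetraVol : Measure (HypSpace × HypSpace × HypSpace) :=
  HypSpace.vol.prod (HypSpace.vol.prod HypSpace.vol)

/-- The tetrahedron amplitude `I₆`, the vertex `x₁` not being integrated over. -/
def tetraAmplitude (ρ : Fin 4 → Fin 4 → ℝ) (x₁ : HypSpace) : ℝ :=
  ∫ p, tetraIntegrand ρ x₁ p ∂tetraVol

end

/-! Write u = cosh d. Each kernel has two bounds: |K_ρ| ≤ d / sinh d ≤ 64 u^(-15/16), free of ρ and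
of singularities, and |K_ρ| ≤ 1 / (ρ sinh d) ≤ ρ⁻¹ u^(-15/16) √(u/(u-1)), which gains 1/ρ but is
singular like 1/d on the diagonal. The second is used on the triangle, the first on the other three
edges. Every triangle leaves out an edge x c at the fixed vertex x, so a single majorant,
nonsingular on x c and weakened to the singular form on the other five edges, covers all four
triangles. It remains to integrate it over a, b, c, uniformly in x.

Volume grows like u du, so a radial function is integrable at infinity once it decays faster than
u^(-2). Integrating over c, four of the fifteen powers of each `decay` go, through the triangle
inequality, into the squares of the decays on x a, x b, a b. The remaining eleven combine to
u^(-33/16), just integrable. The two singularities at c are separated by s t ≤ s² + t², and s² ~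
1/d² is locally integrable in dimension 3; with three singular edges the same device would give the
nonintegrable 1/d³.

The gain raises the triangle x a b from u^(-15/16) to u^(-17/16) on each edge. This passes the
threshold of the Schur-type estimate `lintegral_sing_decay_le`: convolving 1/cosh d with a radial
kernel of decay u^(-17/16) returns at most a multiple of 1/cosh d. It disposes of b, leaving an
integrable radial function of a. -/

noncomputable section

namespace HypSpace

/-! ### Minkowski product and Lorentz boosts -/

/-- The Minkowski product of two points of `H`, the hyperbolic cosine of their distance. -/
def gram (x y : HypSpace) : ℝ := x.time * y.time - inner ℝ x.space y.space

theorem hdist_eq (x y : HypSpace) : hdist x y = Real.arcosh (gram x y) := rfl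

theorem time_pos (x : HypSpace) : 0 < x.time := x.2.2

theorem time_sq (x : HypSpace) : x.time ^ 2 = 1 + ‖x.space‖ ^ 2 := by
  have h := x.2.1
  change x.time ^ 2 - ‖x.space‖ ^ 2 = 1 at h
  linarith

theorem time_eq_sqrt (x : HypSpace) : x.time = √(1 + ‖x.space‖ ^ 2) := by
  rw [← time_sq, Real.sqrt_sq x.time_pos.le]

@[simp] theorem space_chart (v : EuclideanSpace ℝ (Fin 3)) : (chart v).space = v := rfl

theorem time_chart (v : EuclideanSpace ℝ (Fin 3)) : (chart v).time = √(1 + ‖v‖ ^ 2) := rfl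

theorem norm_space_lt_time (x : HypSpace) : ‖x.space‖ < x.time := by
  nlinarith [x.time_sq, x.time_pos, norm_nonneg x.space]

theorem gram_comm (x y : HypSpace) : gram x y = gram y x := by
  rw [gram, gram, real_inner_comm, mul_comm]

/-- Reversed Cauchy–Schwarz: (1 + ab)² ≤ (1 + a²)(1 + b²) for the norms a, b of the spatial parts.
-/
theorem one_le_gram (x y : HypSpace) : 1 ≤ gram x y := by
  have h := real_inner_le_norm x.space y.space
  have h1 : (1 + ‖x.space‖ * ‖y.space‖) ^ 2 ≤ (x.time * y.time) ^ 2 := by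
    rw [mul_pow, time_sq, time_sq]
    nlinarith [sq_nonneg (‖x.space‖ - ‖y.space‖)]
  have h2 := abs_le_of_sq_le_sq' h1 (mul_pos x.time_pos y.time_pos).le
  rw [gram]
  linarith [h2.2]

theorem gram_pos (x y : HypSpace) : 0 < gram x y := one_pos.trans_le (one_le_gram x y)

theorem gram_le_two_mul_time_mul_time (x y : HypSpace) : gram x y ≤ 2 * (x.time * y.time) := by
  have h := neg_le_of_abs_le (abs_real_inner_le_norm x.space y.space)
  have := mul_le_mul x.norm_space_lt_time.le y.norm_space_lt_time.le (norm_nonneg _) x.time_pos.le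
  rw [gram]
  linarith

/-- The Lorentz boost that takes `x` to the base point, read in the chart. -/
def boostSpace (x : HypSpace) (v : EuclideanSpace ℝ (Fin 3)) : EuclideanSpace ℝ (Fin 3) :=
  v + (inner ℝ x.space v / (x.time + 1) - √(1 + ‖v‖ ^ 2)) • x.space

/-- The Lorentz boost that takes `x` to the base point. -/
def boost (x z : HypSpace) : HypSpace := chart (boostSpace x z.space)

theorem boost_chart (x : HypSpace) (v : EuclideanSpace ℝ (Fin 3)) :
    boost x (chart v) = chart (boostSpace x v) := rfl

theorem space_boost (x z : HypSpace) : (boost x z).space =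
    z.space + (inner ℝ x.space z.space / (x.time + 1) - z.time) • x.space := by
  rw [boost, space_chart, boostSpace, ← time_eq_sqrt]

theorem time_boost (x z : HypSpace) : (boost x z).time = gram x z := by
  have h := (boost x z).time_sq
  refine (sq_eq_sq₀ (time_pos _).le (gram_pos x z).le).1 ?_
  rw [h, space_boost, gram, norm_add_sq_real, norm_smul, mul_pow, inner_smul_right,
    Real.norm_eq_abs, sq_abs, real_inner_comm x.space z.space]
  have hx := x.time_sq
  have hz := z.time_sq
  have hpos : x.time + 1 ≠ 0 := by linarith [x.time_pos]
  obtain ⟨a, ha⟩ : ∃ a, a = inner ℝ x.space z.space / (x.time + 1) := ⟨_, rfl⟩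
  have ha' : inner ℝ x.space z.space = a * (x.time + 1) := by rw [ha]; field_simp
  rw [← ha, ha', eq_sub_of_add_eq' hx.symm, eq_sub_of_add_eq' hz.symm]
  ring

theorem gram_boost (x y z : HypSpace) : gram (boost x y) (boost x z) = gram y z := by
  rw [gram, time_boost, time_boost, space_boost, space_boost]
  simp only [gram, inner_add_left, inner_add_right, inner_smul_left, inner_smul_right,
    real_inner_self_eq_norm_sq, RCLike.conj_to_real]
  have hx := x.time_sq
  have hpos : x.time + 1 ≠ 0 := by linarith [x.time_pos]
  obtain ⟨a, ha⟩ : ∃ a, a = inner ℝ x.space z.space / (x.time + 1) := ⟨_, rfl⟩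
  have ha' : inner ℝ x.space z.space = a * (x.time + 1) := by rw [ha]; field_simp
  obtain ⟨b, hb⟩ : ∃ b, b = inner ℝ x.space y.space / (x.time + 1) := ⟨_, rfl⟩
  have hb' : inner ℝ x.space y.space = b * (x.time + 1) := by rw [hb]; field_simp
  rw [← ha, ← hb, real_inner_comm x.space y.space, ha', hb', eq_sub_of_add_eq' hx.symm]
  ring

/-- The triangle inequality in multiplicative form, cosh(r + s) ≤ 2 cosh r cosh s. Boosting z to the
base point turns two of the products into time coordinates. -/
theorem gram_le_two_mul_gram_mul_gram (x y z : HypSpace) :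
    gram x y ≤ 2 * (gram x z * gram z y) := by
  have h := gram_le_two_mul_time_mul_time (boost z x) (boost z y)
  rwa [gram_boost, time_boost, time_boost, gram_comm z x] at h

theorem boostSpace_injective (x : HypSpace) : Function.Injective (boostSpace x) := by
  -- The left inverse is the boost with opposite velocity, that is, with `x.space` replaced by its
  -- negative.
  refine Function.LeftInverse.injective (g := fun w =>
    w + (inner ℝ x.space w / (x.time + 1) + √(1 + ‖w‖ ^ 2)) • x.space) fun v => ?_
  have h1 : √(1 + ‖boostSpace x v‖ ^ 2) = gram x (chart v) :=
    time_boost x (chart v)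
  have h2 : boostSpace x v =
      v + (inner ℝ x.space v / (x.time + 1) - (chart v).time) • x.space := rfl
  have hx := x.time_sq
  have hpos : x.time + 1 ≠ 0 := by linarith [x.time_pos]
  obtain ⟨a, ha⟩ : ∃ a, a = inner ℝ x.space v / (x.time + 1) := ⟨_, rfl⟩
  have ha' : inner ℝ x.space v = a * (x.time + 1) := by rw [ha]; field_simp
  simp only [h1]
  rw [h2, gram, space_chart, inner_add_right, inner_smul_right, real_inner_self_eq_norm_sq,
    ← ha, ha', eq_sub_of_add_eq' hx.symm, add_assoc, ← add_smul]
  convert add_zero v using 2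
  convert zero_smul ℝ x.space using 2
  field_simp
  ring

/-! ### Measurability and boost invariance of the volume -/

theorem measurable_time : Measurable time := measurable_fst.comp measurable_subtype_coe

theorem measurable_space : Measurable space := measurable_snd.comp measurable_subtype_coe

theorem measurable_gram : Measurable fun p : HypSpace × HypSpace => gram p.1 p.2 :=
  ((measurable_time.comp measurable_fst).mul (measurable_time.comp measurable_snd)).sub
    ((measurable_space.comp measurable_fst).inner (measurable_space.comp measurable_snd))

theorem _root_.Measurable.gram {α : Type*} [MeasurableSpace α] {f g : α → HypSpace}
    (hf : Measurable f) (hg : Measurable g) : Measurable fun a => gram (f a) (g a) :=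
  measurable_gram.comp (hf.prodMk hg)

theorem measurable_boost (x : HypSpace) : Measurable (boost x) := by
  refine measurable_chart.comp ?_
  have h : (fun z : HypSpace => boostSpace x z.space) = fun z =>
    z.space + (inner ℝ x.space z.space / (x.time + 1) - √(1 + ‖z.space‖ ^ 2)) • x.space := rfl
  rw [h]
  have := measurable_space
  fun_prop

instance : SFinite vol := by unfold vol; infer_instance

theorem lintegral_vol {f : HypSpace → ENNReal} (hf : Measurable f) :
    ∫⁻ z, f z ∂vol = ∫⁻ v, ENNReal.ofReal (1 / √(1 + ‖v‖ ^ 2)) * f (chart v) := by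
  rw [vol, lintegral_map hf measurable_chart,
    lintegral_withDensity_eq_lintegral_mul _ (by fun_prop)
      (show Measurable fun v => f (chart v) from hf.comp measurable_chart)]
  rfl

theorem hasFDerivAt_boostSpace (x : HypSpace) (v : EuclideanSpace ℝ (Fin 3)) :
    HasFDerivAt (boostSpace x) (ContinuousLinearMap.id ℝ (EuclideanSpace ℝ (Fin 3)) +
      ((x.time + 1)⁻¹ • innerSL ℝ x.space - (√(1 + ‖v‖ ^ 2))⁻¹ • innerSL ℝ v).smulRight
        x.space) v := by
  have h1 : HasFDerivAt (fun w : EuclideanSpace ℝ (Fin 3) => inner ℝ x.space w / (x.time + 1))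
      ((x.time + 1)⁻¹ • innerSL ℝ x.space) v := by
    simpa [div_eq_inv_mul] using (innerSL ℝ x.space).hasFDerivAt.const_mul (x.time + 1)⁻¹
  have hpos : 0 < 1 + ‖v‖ ^ 2 := by positivity
  have h2 : HasFDerivAt (fun w : EuclideanSpace ℝ (Fin 3) => √(1 + ‖w‖ ^ 2))
      ((√(1 + ‖v‖ ^ 2))⁻¹ • innerSL ℝ v) v := by
    have := ((hasStrictFDerivAt_norm_sq v).hasFDerivAt.const_add 1).sqrt hpos.ne'
    rw [← Nat.cast_smul_eq_nsmul ℝ 2, smul_smul] at this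
    have e : 1 / (2 * √(1 + ‖v‖ ^ 2)) * ((2 : ℕ) : ℝ) = (√(1 + ‖v‖ ^ 2))⁻¹ := by
      push_cast
      field_simp
    rwa [e] at this
  exact (hasFDerivAt_id v).add ((h1.sub h2).smul_const x.space)

/-- The derivative is the identity plus a rank-one map, so its determinant is one plus the
functional evaluated at the vector. The value is the ratio of the new time coordinate to the old
one, exactly what the density of the volume compensates. -/
theorem det_fderiv_boostSpace (x : HypSpace) (v : EuclideanSpace ℝ (Fin 3)) :
    (ContinuousLinearMap.id ℝ (EuclideanSpace ℝ (Fin 3)) +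
      ((x.time + 1)⁻¹ • innerSL ℝ x.space - (√(1 + ‖v‖ ^ 2))⁻¹ • innerSL ℝ v).smulRight
        x.space).det = gram x (chart v) / √(1 + ‖v‖ ^ 2) := by
  have h := LinearMap.transvection.det
    (((x.time + 1)⁻¹ • innerSL ℝ x.space - (√(1 + ‖v‖ ^ 2))⁻¹ • innerSL ℝ v :
      EuclideanSpace ℝ (Fin 3) →L[ℝ] ℝ) : EuclideanSpace ℝ (Fin 3) →ₗ[ℝ] ℝ) x.space
  have hx := x.time_sq
  have hpos : x.time + 1 ≠ 0 := by linarith [x.time_pos]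
  have hv : √(1 + ‖v‖ ^ 2) ≠ 0 := (Real.sqrt_pos.2 (by positivity)).ne'
  have e : 1 + (((x.time + 1)⁻¹ • innerSL ℝ x.space - (√(1 + ‖v‖ ^ 2))⁻¹ • innerSL ℝ v :
      EuclideanSpace ℝ (Fin 3) →L[ℝ] ℝ) : EuclideanSpace ℝ (Fin 3) →ₗ[ℝ] ℝ) x.space
      = gram x (chart v) / √(1 + ‖v‖ ^ 2) := by
    simp only [ContinuousLinearMap.coe_coe, sub_apply,
      smul_apply, innerSL_apply_apply, real_inner_self_eq_norm_sq, smul_eq_mul,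
      gram, space_chart, time_chart]
    rw [eq_sub_of_add_eq' hx.symm, real_inner_comm]
    field_simp
    ring
  rw [← e, ← h]
  rfl

/-- The volume is invariant under boosts. -/
theorem lintegral_comp_boost_le (x : HypSpace) {f : HypSpace → ENNReal} (hf : Measurable f) :
    ∫⁻ z, f (boost x z) ∂vol ≤ ∫⁻ z, f z ∂vol := by
  rw [lintegral_vol hf,
    lintegral_vol (show Measurable fun z => f (boost x z) from hf.comp (measurable_boost x))]
  calc _ = ∫⁻ v, ENNReal.ofReal |gram x (chart v) / √(1 + ‖v‖ ^ 2)| *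
        (ENNReal.ofReal (1 / √(1 + ‖boostSpace x v‖ ^ 2)) * f (chart (boostSpace x v))) := by
        refine lintegral_congr fun v => ?_
        have hg := gram_pos x (chart v)
        have h1 : √(1 + ‖boostSpace x v‖ ^ 2) = gram x (chart v) := time_boost x (chart v)
        have hv : 0 < √(1 + ‖v‖ ^ 2) := Real.sqrt_pos.2 (by positivity)
        rw [h1, ← mul_assoc, ← ENNReal.ofReal_mul (abs_nonneg _), abs_of_pos (by positivity),
          boost_chart]
        congr 2
        field_simp
    _ = ∫⁻ w in boostSpace x '' Set.univ,
          ENNReal.ofReal (1 / √(1 + ‖w‖ ^ 2)) * f (chart w) := by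
        rw [lintegral_image_eq_lintegral_abs_det_fderiv_mul volume MeasurableSet.univ
          (fun v _ => (hasFDerivAt_boostSpace x v).hasFDerivWithinAt)
          (boostSpace_injective x).injOn, setLIntegral_univ]
        simp only [det_fderiv_boostSpace]
    -- Only an upper bound is needed, so surjectivity of the boost plays no role.
    _ ≤ _ := setLIntegral_le_lintegral _ _

/-! ### Decaying and singular factors -/

/-- The decaying factor `u ^ (-1/16)` of a function of `u = cosh d`. -/
def decay (u : ℝ) : ENNReal := ENNReal.ofReal (u ^ (-(1 / 16) : ℝ))

/-- The factor `√(u / (u - 1))` of a function of `u = cosh d`, singular on the diagonal. -/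
def sing (u : ℝ) : ENNReal := (1 + (ENNReal.ofReal (u - 1))⁻¹) ^ (1 / 2 : ℝ)

theorem measurable_decay : Measurable decay := by unfold decay; fun_prop

theorem measurable_sing : Measurable sing := by unfold sing; fun_prop

theorem sing_sq (u : ℝ) : sing u ^ 2 = 1 + (ENNReal.ofReal (u - 1))⁻¹ := by
  rw [sing, ← ENNReal.rpow_natCast, ← ENNReal.rpow_mul]
  norm_num

theorem one_le_sing (u : ℝ) : 1 ≤ sing u := by
  have h : (1 : ENNReal) ≤ 1 + (ENNReal.ofReal (u - 1))⁻¹ := le_self_add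
  simpa [sing] using ENNReal.rpow_le_rpow h (by norm_num : (0 : ℝ) ≤ 1 / 2)

theorem sing_sq_of_one_lt {u : ℝ} (hu : 1 < u) :
    sing u ^ 2 = ENNReal.ofReal (1 + 1 / (u - 1)) := by
  have h : 0 < u - 1 := by linarith
  rw [sing_sq, ENNReal.ofReal_add zero_le_one (by positivity), one_div,
    ENNReal.ofReal_inv_of_pos h, ENNReal.ofReal_one]

theorem decay_pow {u : ℝ} (hu : 0 ≤ u) (n : ℕ) :
    decay u ^ n = ENNReal.ofReal (u ^ (-(n / 16) : ℝ)) := by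
  rw [decay, ← ENNReal.ofReal_pow (by positivity), ← Real.rpow_natCast, ← Real.rpow_mul hu]
  ring_nf

theorem decay_le_one {u : ℝ} (hu : 1 ≤ u) : decay u ≤ 1 :=
  ENNReal.ofReal_le_one.2 (Real.rpow_le_one_of_one_le_of_nonpos hu (by norm_num))

theorem decay_pow_sixteen {u : ℝ} (hu : 0 ≤ u) : decay u ^ 16 = ENNReal.ofReal (1 / u) := by
  rw [decay_pow hu]
  norm_num [Real.rpow_neg_one]

/-! ### Convolution estimate for 1/cosh d -/

theorem integrable_prod_japanese : Integrable fun v : EuclideanSpace ℝ (Fin 3) =>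
    ∏ i, (1 + v i ^ 2) ^ (-(49 / 96) : ℝ) := by
  have h1 : Integrable fun x : ℝ => (1 + x ^ 2) ^ (-(49 / 96) : ℝ) := by
    have := integrable_rpow_neg_one_add_norm_sq (E := ℝ) (μ := volume) (r := 49 / 48)
      (by norm_num)
    norm_num [Real.norm_eq_abs, sq_abs] at this ⊢
    exact this
  have h3 : Integrable fun x : Fin 3 → ℝ => ∏ i, (1 + x i ^ 2) ^ (-(49 / 96) : ℝ) :=
    Integrable.fintype_prod (f := fun (_ : Fin 3) (x : ℝ) => (1 + x ^ 2) ^ (-(49 / 96) : ℝ))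
      fun _ => h1
  exact ((EuclideanSpace.volume_preserving_symm_measurableEquiv_toLp (Fin 3)).integrable_comp_emb
    (MeasurableEquiv.measurableEmbedding _)).2 h3

theorem integrable_indicator_ball_inv_norm_sq : Integrable
    ((Metric.ball (0 : EuclideanSpace ℝ (Fin 3)) 1).indicator fun v => (‖v‖ ^ 2)⁻¹) := by
  rw [integrable_indicator_iff Metric.isOpen_ball.measurableSet,
    integrableOn_fun_norm_addHaar volume (f := fun y : ℝ => (y ^ 2)⁻¹)]
  refine (integrableOn_const (C := (1 : ℝ)) (by simp)).congr_fun (fun y hy => ?_) measurableSet_Ioo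
  have : y ≠ 0 := hy.1.ne'
  simp
  field_simp

/-- The factor 1/(1 + b² + c²) alone does not decay along the a-axis, and borderline powers must be
shared among three one-dimensional integrals. With T = 1 + a² + b² + c², the power T^(-17/32) splits
as T^(-49/96) T^(-1/48): the first part serves a, the second lifts the exponent of 1 + b² + c² to
49/48 = 2 · 49/96, which serves b and c. Integrability on the line holds because 49/96 > 1/2. -/
theorem rpow_mul_inv_le_prod_japanese (a b c : ℝ) :
    (√(1 + (a ^ 2 + b ^ 2 + c ^ 2))) ^ (-(17 / 16) : ℝ) * (1 / (1 + b ^ 2 + c ^ 2)) ≤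
      (1 + a ^ 2) ^ (-(49 / 96) : ℝ) * (1 + b ^ 2) ^ (-(49 / 96) : ℝ) *
        (1 + c ^ 2) ^ (-(49 / 96) : ℝ) := by
  have hP : 0 < 1 + b ^ 2 + c ^ 2 := by positivity
  have hT : 0 < 1 + (a ^ 2 + b ^ 2 + c ^ 2) := by positivity
  have hA : 0 < 1 + a ^ 2 := by positivity
  calc _ = (1 + (a ^ 2 + b ^ 2 + c ^ 2)) ^ (-(49 / 96) : ℝ) *
        ((1 + (a ^ 2 + b ^ 2 + c ^ 2)) ^ (-(1 / 48) : ℝ) * (1 + b ^ 2 + c ^ 2) ^ (-1 : ℝ)) := by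
        rw [← mul_assoc, ← Real.rpow_add hT, Real.sqrt_eq_rpow, ← Real.rpow_mul hT.le,
          Real.rpow_neg_one, one_div]
        norm_num
    _ ≤ (1 + a ^ 2) ^ (-(49 / 96) : ℝ) *
        ((1 + b ^ 2 + c ^ 2) ^ (-(1 / 48) : ℝ) * (1 + b ^ 2 + c ^ 2) ^ (-1 : ℝ)) := by
        gcongr ?_ * (?_ * _)
        · exact Real.rpow_le_rpow_of_nonpos hA (by nlinarith) (by norm_num)
        · exact Real.rpow_le_rpow_of_nonpos hP (by nlinarith) (by norm_num)
    _ = (1 + a ^ 2) ^ (-(49 / 96) : ℝ) * ((1 + b ^ 2 + c ^ 2) ^ 2) ^ (-(49 / 96) : ℝ) := by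
        rw [← Real.rpow_add hP, ← Real.rpow_natCast (1 + b ^ 2 + c ^ 2), ← Real.rpow_mul hP.le]
        norm_num
    _ ≤ _ := by
        rw [mul_assoc, ← Real.mul_rpow (x := 1 + b ^ 2) (by positivity) (by positivity)]
        refine mul_le_mul_of_nonneg_left (Real.rpow_le_rpow_of_nonpos (by positivity) ?_
          (by norm_num)) (by positivity)
        nlinarith [sq_nonneg (b ^ 2 + c ^ 2), sq_nonneg (b * c), sq_nonneg b, sq_nonneg c]

/-- The comparison, by an integrable function of the chart, that makes the Schur integral
finite. -/
theorem weight_coord_le {v : EuclideanSpace ℝ (Fin 3)} (hv : v ≠ 0) :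
    ENNReal.ofReal (1 / √(1 + ‖v‖ ^ 2)) * (sing (√(1 + ‖v‖ ^ 2)) ^ 2 *
        decay (√(1 + ‖v‖ ^ 2)) ^ 17 *
          ENNReal.ofReal (2 * √(1 + ‖v‖ ^ 2) / (1 + ‖v‖ ^ 2 - v 0 ^ 2))) ≤
      ENNReal.ofReal (8 * ∏ i, (1 + v i ^ 2) ^ (-(49 / 96) : ℝ) +
        8 * (Metric.ball 0 1).indicator (fun v => (‖v‖ ^ 2)⁻¹) v) := by
  have hn : 0 < ‖v‖ := norm_pos_iff.2 hv
  have hsum : ‖v‖ ^ 2 = v 0 ^ 2 + v 1 ^ 2 + v 2 ^ 2 := by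
    rw [EuclideanSpace.real_norm_sq_eq, Fin.sum_univ_three]
  obtain ⟨t, ht⟩ : ∃ t, t = √(1 + ‖v‖ ^ 2) := ⟨_, rfl⟩
  have ht2 : t ^ 2 = 1 + ‖v‖ ^ 2 := by rw [ht, Real.sq_sqrt (by positivity)]
  have ht0 : 0 ≤ t := ht ▸ Real.sqrt_nonneg _
  have ht1 : 1 < t := by nlinarith
  have hP : 0 < 1 + ‖v‖ ^ 2 - v 0 ^ 2 := by rw [hsum]; nlinarith [sq_nonneg (v 1), sq_nonneg (v 2)]
  have hu : 0 < t - 1 := by linarith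
  rw [← ht, sing_sq_of_one_lt ht1, decay_pow ht0, ← ENNReal.ofReal_mul (by positivity),
    ← ENNReal.ofReal_mul (by positivity), ← ENNReal.ofReal_mul (by positivity)]
  refine ENNReal.ofReal_le_ofReal ?_
  have hj := rpow_mul_inv_le_prod_japanese (v 0) (v 1) (v 2)
  rw [← hsum, ← ht] at hj
  have hP' : 1 + v 1 ^ 2 + v 2 ^ 2 = 1 + ‖v‖ ^ 2 - v 0 ^ 2 := by rw [hsum]; ring
  rw [hP'] at hj
  rw [Fin.prod_univ_three]
  have hr : t ^ (-(17 / 16) : ℝ) ≤ 1 := Real.rpow_le_one_of_one_le_of_nonpos ht1.le (by norm_num)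
  have hr0 : 0 < t ^ (-(17 / 16) : ℝ) := by positivity
  have hP1 : 1 / (1 + ‖v‖ ^ 2 - v 0 ^ 2) ≤ 1 := by
    rw [div_le_one hP, hsum]; nlinarith [sq_nonneg (v 1), sq_nonneg (v 2)]
  have e : 1 / t * ((1 + 1 / (t - 1)) * t ^ (-((17 : ℕ) / 16) : ℝ) *
      (2 * t / (1 + ‖v‖ ^ 2 - v 0 ^ 2))) = 2 * (1 + 1 / (t - 1)) *
        (t ^ (-(17 / 16) : ℝ) * (1 / (1 + ‖v‖ ^ 2 - v 0 ^ 2))) := by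
    push_cast
    field_simp
  rw [e]
  have hinv : 1 / (t - 1) = (t + 1) / ‖v‖ ^ 2 := by
    rw [eq_sub_of_add_eq' ht2.symm]
    have : t ^ 2 - 1 ≠ 0 := by nlinarith
    field_simp
    ring
  -- Inside the unit ball the singularity is at most 4/‖v‖², and the decaying factors are at most 1.
  -- Outside it t ≥ 4/3, so the singular factor is at most 4 and the product bound applies.
  by_cases h : ‖v‖ < 1
  · rw [Set.indicator_of_mem (by simpa using h)]
    have h1 : 1 + 1 / (t - 1) ≤ 4 * (‖v‖ ^ 2)⁻¹ := by
      have ht' : t ≤ 2 := by nlinarith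
      rw [hinv, ← div_eq_mul_inv, le_div_iff₀ (by positivity), add_mul,
        div_mul_cancel₀ _ (by positivity)]
      nlinarith
    calc _ ≤ 2 * (4 * (‖v‖ ^ 2)⁻¹) * (1 * 1) := by gcongr
      _ ≤ _ := by
        have : 0 ≤ 8 * ((1 + v 0 ^ 2) ^ (-(49 / 96) : ℝ) * (1 + v 1 ^ 2) ^ (-(49 / 96) : ℝ) *
          (1 + v 2 ^ 2) ^ (-(49 / 96) : ℝ)) := by positivity
        linarith
  · rw [Set.indicator_of_notMem (by simpa using h)]
    have h1 : 1 + 1 / (t - 1) ≤ 4 := by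
      push Not at h
      have ht' : (4 : ℝ) / 3 ≤ t := by nlinarith
      have : 1 / (t - 1) ≤ 3 := by rw [div_le_iff₀ hu]; linarith
      linarith
    calc _ ≤ 2 * 4 * ((1 + v 0 ^ 2) ^ (-(49 / 96) : ℝ) * (1 + v 1 ^ 2) ^ (-(49 / 96) : ℝ) *
          (1 + v 2 ^ 2) ^ (-(49 / 96) : ℝ)) := by gcongr
      _ = _ := by ring

/-- The weight that dominates the Schur integral seen from the base point, in the direction `e`. -/
def schurWeight (e v : EuclideanSpace ℝ (Fin 3)) : ENNReal :=
  ENNReal.ofReal (1 / √(1 + ‖v‖ ^ 2)) * (sing (√(1 + ‖v‖ ^ 2)) ^ 2 *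
    decay (√(1 + ‖v‖ ^ 2)) ^ 17 *
      ENNReal.ofReal (2 * √(1 + ‖v‖ ^ 2) / (1 + ‖v‖ ^ 2 - inner ℝ e v ^ 2)))

/-- The value, independent of the direction, of the integral of `schurWeight`. -/
def schurConst : ENNReal := ∫⁻ v, schurWeight (EuclideanSpace.single 0 1) v

theorem schurConst_lt_top : schurConst < ⊤ := by
  have h := ((integrable_prod_japanese.const_mul 8).add
    (integrable_indicator_ball_inv_norm_sq.const_mul 8)).lintegral_lt_top
  refine lt_of_le_of_lt (lintegral_mono_ae ?_) h
  have h0 : ∀ᵐ v : EuclideanSpace ℝ (Fin 3), v ≠ 0 := by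
    simp [ae_iff]
  filter_upwards [h0] with v hv
  have := weight_coord_le hv
  simpa [schurWeight, EuclideanSpace.inner_single_left] using this

/-- The reflection exchanging `e` with the first basis vector preserves Lebesgue measure and norms.
-/
theorem lintegral_schurWeight {e : EuclideanSpace ℝ (Fin 3)} (he : ‖e‖ = 1) :
    ∫⁻ v, schurWeight e v = schurConst := by
  have hR := Submodule.reflection_sub (v := e) (w := EuclideanSpace.single (0 : Fin 3) (1 : ℝ))
    (by simpa using he)
  set R := (ℝ ∙ (e - EuclideanSpace.single (0 : Fin 3) (1 : ℝ)))ᗮ.reflection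
  rw [schurConst, ← (LinearIsometryEquiv.measurePreserving R).lintegral_comp_emb
    R.toHomeomorph.measurableEmbedding
    (schurWeight (EuclideanSpace.single 0 1))]
  refine lintegral_congr fun v => ?_
  rw [schurWeight, schurWeight, LinearIsometryEquiv.norm_map, ← hR,
    LinearIsometryEquiv.inner_map_map]

/-- The dependence on the distance of y from the base point factors out, leaving only its direction:
the product is at least `y.time * (z.time - |w|)`. Rationalizing 1/(`z.time` - |w|) gives a
denominator in the squared norm of z transverse to e. -/
theorem inv_gram_le (y z : HypSpace) {e : EuclideanSpace ℝ (Fin 3)}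
    (he : ‖e‖ = 1) (hy : y.space = ‖y.space‖ • e) :
    1 / gram y z ≤ 1 / y.time *
      (2 * z.time / (1 + ‖z.space‖ ^ 2 - inner ℝ e z.space ^ 2)) := by
  obtain ⟨w, hw⟩ : ∃ w, w = inner ℝ e z.space := ⟨_, rfl⟩
  have hwz : |w| ≤ ‖z.space‖ := by
    simpa [hw, he] using abs_real_inner_le_norm e z.space
  have hzt := z.norm_space_lt_time
  have hyt := y.norm_space_lt_time
  have h1 : y.time * (z.time - |w|) ≤ gram y z := by
    have : inner ℝ y.space z.space ≤ y.time * |w| := by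
      rw [hy, real_inner_smul_left, ← hw]
      calc ‖y.space‖ * w ≤ ‖y.space‖ * |w| := by gcongr; exact le_abs_self w
        _ ≤ y.time * |w| := by gcongr
    rw [gram]
    linarith
  have hz : 0 < z.time - |w| := by linarith
  have hyp := y.time_pos
  have hsq : 1 + ‖z.space‖ ^ 2 - w ^ 2 = (z.time - |w|) * (z.time + |w|) := by
    rw [← z.time_sq, ← sq_abs w]
    ring
  have hw0 := abs_nonneg w
  rw [← hw, hsq]
  calc 1 / gram y z ≤ 1 / (y.time * (z.time - |w|)) :=
        one_div_le_one_div_of_le (by positivity) h1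
    _ = 1 / y.time * ((z.time + |w|) / ((z.time - |w|) * (z.time + |w|))) := by
        have : z.time + |w| ≠ 0 := by linarith
        field_simp
    _ ≤ _ := by
        have : 0 < z.time + |w| := by linarith
        gcongr
        linarith

theorem exists_unit_direction (v : EuclideanSpace ℝ (Fin 3)) :
    ∃ e : EuclideanSpace ℝ (Fin 3), ‖e‖ = 1 ∧ v = ‖v‖ • e := by
  by_cases h : v = 0
  · exact ⟨EuclideanSpace.single 0 1, by simp, by simp [h]⟩
  · have h' : ‖v‖ ≠ 0 := norm_ne_zero_iff.2 h
    exact ⟨‖v‖⁻¹ • v, by simp [norm_smul, h'], by rw [smul_smul, mul_inv_cancel₀ h', one_smul]⟩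

/-- The reciprocal of `cosh d` is an approximate eigenfunction of convolution by an integrable
radial kernel. -/
theorem lintegral_sing_decay_le (x y : HypSpace) :
    ∫⁻ z, sing (gram x z) ^ 2 * decay (gram x z) ^ 17 * decay (gram y z) ^ 16 ∂vol ≤
      schurConst * decay (gram x y) ^ 16 := by
  obtain ⟨e, he, hye⟩ := exists_unit_direction (boost x y).space
  have hm : Measurable fun z : HypSpace => sing z.time ^ 2 * decay z.time ^ 17 *
      decay (gram (boost x y) z) ^ 16 :=
    (((measurable_sing.comp measurable_time).pow_const 2).mul
      ((measurable_decay.comp measurable_time).pow_const 17)).mul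
      ((measurable_decay.comp (measurable_const.gram measurable_id)).pow_const 16)
  calc _ = ∫⁻ z, sing (boost x z).time ^ 2 * decay (boost x z).time ^ 17 *
        decay (gram (boost x y) (boost x z)) ^ 16 ∂vol := by
        simp only [time_boost, gram_boost]
    _ ≤ _ := lintegral_comp_boost_le x hm
    _ ≤ ∫⁻ v, schurWeight e v * ENNReal.ofReal (1 / (boost x y).time) := by
        rw [lintegral_vol hm]
        refine lintegral_mono fun v => ?_
        have h : ENNReal.ofReal (1 / gram (boost x y) (chart v)) ≤
            ENNReal.ofReal (2 * √(1 + ‖v‖ ^ 2) / (1 + ‖v‖ ^ 2 - inner ℝ e v ^ 2)) *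
              ENNReal.ofReal (1 / (boost x y).time) := by
          rw [← ENNReal.ofReal_mul' (one_div_pos.2 (boost x y).time_pos).le, mul_comm]
          exact ENNReal.ofReal_le_ofReal (inv_gram_le (boost x y) (chart v) he hye)
        rw [decay_pow_sixteen (gram_pos _ _).le, schurWeight, mul_assoc, mul_assoc,
          mul_assoc, mul_assoc, time_chart]
        gcongr
    _ = _ := by
        rw [lintegral_mul_const' _ _ ENNReal.ofReal_ne_top, lintegral_schurWeight he, time_boost,
          decay_pow_sixteen (gram_pos _ _).le]

end HypSpace

/-! ### Pointwise inequalities and majorants -/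

theorem ENNReal.mul_le_sq_add_sq (a b : ENNReal) : a * b ≤ a ^ 2 + b ^ 2 := by
  rcases le_total a b with h | h
  · exact (mul_le_mul_left h b).trans (sq b ▸ le_add_self)
  · exact (mul_le_mul_right h a).trans (sq a ▸ le_self_add)

theorem ENNReal.mul_mul_le_pow_three_add (a b c : ENNReal) :
    a * b * c ≤ a ^ 3 + b ^ 3 + c ^ 3 := by
  have key : a * b * c ≤ (a ⊔ b ⊔ c) ^ 3 := by
    rw [pow_succ, sq]
    gcongr
    · exact le_sup_left.trans le_sup_left
    · exact le_sup_right.trans le_sup_left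
    · exact le_sup_right
  refine key.trans ?_
  rcases max_choice (a ⊔ b) c with h | h
  · rw [h]
    rcases max_choice a b with h | h
    · rw [h, add_assoc]; exact le_self_add
    · rw [h]; exact le_add_self.trans le_self_add
  · rw [h]; exact le_add_self

namespace HypSpace

/-- For u ≥ 2 the square u/(u-1) is at most 2; for u ≤ 2 the decay is at least 2^(-33/16) ≥ 1/8.
This isolates an integrable local singularity from a bounded remainder. -/
theorem sing_sq_le {u : ℝ} (hu : 1 ≤ u) : sing u ^ 2 ≤ 2 + 8 * (sing u ^ 2 * decay u ^ 33) := by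
  rcases le_total u 2 with h | h
  · have h1 : 1 ≤ 8 * decay u ^ 33 := by
      have h2 : (1 : ℝ) / 8 ≤ u ^ (-((33 : ℕ) / 16) : ℝ) := by
        calc (1 : ℝ) / 8 = 2 ^ (-3 : ℝ) := by
              rw [Real.rpow_neg zero_le_two]; norm_num
          _ ≤ 2 ^ (-((33 : ℕ) / 16) : ℝ) :=
              Real.rpow_le_rpow_of_exponent_le one_le_two (by norm_num)
          _ ≤ _ := Real.rpow_le_rpow_of_nonpos (by linarith) h (by norm_num)
      rw [decay_pow (by linarith), ← ENNReal.ofReal_ofNat, ← ENNReal.ofReal_mul (by norm_num)]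
      exact ENNReal.one_le_ofReal.2 (by linarith)
    calc sing u ^ 2 = sing u ^ 2 * 1 := (mul_one _).symm
      _ ≤ sing u ^ 2 * (8 * decay u ^ 33) := by gcongr
      _ = 8 * (sing u ^ 2 * decay u ^ 33) := by ring
      _ ≤ _ := le_add_self
  · refine le_add_right ?_
    rw [sing_sq_of_one_lt (by linarith), ← ENNReal.ofReal_ofNat]
    refine ENNReal.ofReal_le_ofReal ?_
    have : 1 / (u - 1) ≤ 1 := by rw [div_le_one (by linarith)]; linarith
    linarith

theorem decay_gram_mul_decay_gram_le (x y z : HypSpace) :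
    decay (gram x z) * decay (gram z y) ≤ 2 * decay (gram x y) := by
  have hxz := gram_pos x z
  have hzy := gram_pos z y
  have hxy := gram_pos x y
  have h := gram_le_two_mul_gram_mul_gram x y z
  rw [decay, decay, decay, ← ENNReal.ofReal_mul (by positivity), ← ENNReal.ofReal_ofNat,
    ← ENNReal.ofReal_mul (by norm_num), ← Real.mul_rpow hxz.le hzy.le]
  refine ENNReal.ofReal_le_ofReal ?_
  calc (gram x z * gram z y) ^ (-(1 / 16) : ℝ) ≤ (2⁻¹ * gram x y) ^ (-(1 / 16) : ℝ) :=
        Real.rpow_le_rpow_of_nonpos (by positivity) (by linarith) (by norm_num)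
    _ = 2 ^ (1 / 16 : ℝ) * gram x y ^ (-(1 / 16) : ℝ) := by
        rw [Real.mul_rpow (by norm_num) hxy.le, Real.inv_rpow (by norm_num),
          Real.rpow_neg (by norm_num), inv_inv]
    _ ≤ 2 ^ (1 : ℝ) * gram x y ^ (-(1 / 16) : ℝ) := by
        gcongr <;> norm_num
    _ = _ := by rw [Real.rpow_one]

/-- The kernel majorant carrying the singularity on the diagonal. -/
def majorant (x y : HypSpace) : ENNReal := decay (gram x y) ^ 15 * sing (gram x y)

theorem majorant_comm (x y : HypSpace) : majorant x y = majorant y x := by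
  rw [majorant, majorant, gram_comm]

theorem decay_pow_le_majorant (x y : HypSpace) : decay (gram x y) ^ 15 ≤ majorant x y := by
  rw [majorant]
  exact le_mul_of_one_le_right' (one_le_sing _)

/-- The majorant of the tetrahedron integrand, without singularity on the edge `x c`. -/
def tetraMajorant (x a b c : HypSpace) : ENNReal :=
  majorant x a * majorant x b * majorant a b *
    (decay (gram x c) ^ 15 * majorant a c * majorant b c)

theorem _root_.Measurable.decay_gram {α : Type*} [MeasurableSpace α] {f g : α → HypSpace}
    (hf : Measurable f) (hg : Measurable g) : Measurable fun a => decay (gram (f a) (g a)) :=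
  measurable_decay.comp (hf.gram hg)

theorem _root_.Measurable.sing_gram {α : Type*} [MeasurableSpace α] {f g : α → HypSpace}
    (hf : Measurable f) (hg : Measurable g) : Measurable fun a => sing (gram (f a) (g a)) :=
  measurable_sing.comp (hf.gram hg)

theorem _root_.Measurable.majorant {α : Type*} [MeasurableSpace α] {f g : α → HypSpace}
    (hf : Measurable f) (hg : Measurable g) : Measurable fun a => majorant (f a) (g a) :=
  ((hf.decay_gram hg).pow_const 15).mul (hf.sing_gram hg)

theorem _root_.Measurable.tetraMajorant {α : Type*} [MeasurableSpace α]
    {f g h k : α → HypSpace} (hf : Measurable f) (hg : Measurable g) (hh : Measurable h)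
    (hk : Measurable k) : Measurable fun a => tetraMajorant (f a) (g a) (h a) (k a) :=
  (((hf.majorant hg).mul (hf.majorant hh)).mul (hg.majorant hh)).mul
    ((((hf.decay_gram hk).pow_const 15).mul (hg.majorant hk)).mul (hh.majorant hk))

/-- The integrable radial function that all estimates are reduced to. -/
def bump (x y : HypSpace) : ENNReal := sing (gram x y) ^ 2 * decay (gram x y) ^ 33

theorem measurable_bump (x : HypSpace) : Measurable (bump x) :=
  ((measurable_const.sing_gram measurable_id).pow_const 2).mul
    ((measurable_const.decay_gram measurable_id).pow_const 33)

theorem lintegral_bump_le (x : HypSpace) : ∫⁻ z, bump x z ∂vol ≤ schurConst := by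
  calc _ = ∫⁻ z, sing (gram x z) ^ 2 * decay (gram x z) ^ 17 * decay (gram x z) ^ 16 ∂vol :=
        lintegral_congr fun z => by rw [bump]; ring
    _ ≤ schurConst * decay (gram x x) ^ 16 := lintegral_sing_decay_le x x
    _ ≤ schurConst * 1 := by
        gcongr
        exact pow_le_one' (decay_le_one (one_le_gram x x)) _
    _ = _ := mul_one _

theorem decay_pow_le_bump (x y : HypSpace) : decay (gram x y) ^ 33 ≤ bump x y :=
  le_mul_of_one_le_left' (one_le_pow_of_one_le' (one_le_sing _) 2)

/-! ### Integrating out the free vertices -/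

theorem decay_mul_majorant_mul_majorant_le (x a b c : HypSpace) :
    decay (gram x c) ^ 15 * majorant a c * majorant b c ≤
      64 * (decay (gram x a) * decay (gram x b) * decay (gram a b)) ^ 2 *
        (12 * (bump x c + bump a c + bump b c)) := by
  have hxa := decay_gram_mul_decay_gram_le x a c
  have hxb := decay_gram_mul_decay_gram_le x b c
  have hab := decay_gram_mul_decay_gram_le a b c
  rw [gram_comm c a] at hxa
  rw [gram_comm c b] at hxb hab
  have hx1 := decay_le_one (one_le_gram x c)
  have ha1 := decay_le_one (one_le_gram a c)
  have hb1 := decay_le_one (one_le_gram b c)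
  have hsa := sing_sq_le (one_le_gram a c)
  have hsb := sing_sq_le (one_le_gram b c)
  have hbx := decay_pow_le_bump x c
  have hba := decay_pow_le_bump a c
  have hbb := decay_pow_le_bump b c
  change _ ≤ 2 + 8 * bump a c at hsa
  change _ ≤ 2 + 8 * bump b c at hsb
  rw [majorant, majorant]
  generalize decay (gram x c) = wx at *
  generalize decay (gram a c) = wa at *
  generalize decay (gram b c) = wb at *
  generalize sing (gram a c) = sa at *
  generalize sing (gram b c) = sb at *
  have h1 : (wx * wa * wb) ^ 11 ≤ bump x c + bump a c + bump b c := by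
    calc (wx * wa * wb) ^ 11 = wx ^ 11 * wa ^ 11 * wb ^ 11 := by ring
      _ ≤ _ := ENNReal.mul_mul_le_pow_three_add _ _ _
      _ = wx ^ 33 + wa ^ 33 + wb ^ 33 := by ring
      _ ≤ _ := by gcongr
  have h2 : (wx * wa * wb) ^ 11 ≤ 1 := pow_le_one' (mul_le_one' (mul_le_one' hx1 ha1) hb1) _
  -- Each weight lies in two of the three squared pairs, so 15 = 4 + 11. Each pair is spent on the
  -- triangle inequality through c, and the eleventh powers yield 33 = 3 · 11, where 33/16 > 2.
  calc wx ^ 15 * (wa ^ 15 * sa) * (wb ^ 15 * sb)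
      = ((wx * wa) * (wx * wb) * (wa * wb)) ^ 2 * ((sa * sb) * (wx * wa * wb) ^ 11) := by ring
    _ ≤ ((2 * decay (gram x a)) * (2 * decay (gram x b)) * (2 * decay (gram a b))) ^ 2 *
        (((2 + 8 * bump a c) + (2 + 8 * bump b c)) * (wx * wa * wb) ^ 11) := by
        gcongr
        exact (ENNReal.mul_le_sq_add_sq sa sb).trans (add_le_add hsa hsb)
    _ = 64 * (decay (gram x a) * decay (gram x b) * decay (gram a b)) ^ 2 *
        (4 * (wx * wa * wb) ^ 11 + 8 * (bump a c + bump b c) * (wx * wa * wb) ^ 11) := by ring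
    _ ≤ 64 * (decay (gram x a) * decay (gram x b) * decay (gram a b)) ^ 2 *
        (4 * (bump x c + bump a c + bump b c) + 8 * (0 + bump a c + bump b c) * 1) := by
        rw [zero_add]
        gcongr
    _ ≤ 64 * (decay (gram x a) * decay (gram x b) * decay (gram a b)) ^ 2 *
        (4 * (bump x c + bump a c + bump b c) + 8 * (bump x c + bump a c + bump b c) * 1) := by
        gcongr
        exact zero_le
    _ = _ := by ring

theorem lintegral_decay_mul_majorant_mul_majorant_le (x a b : HypSpace) :
    ∫⁻ c, decay (gram x c) ^ 15 * majorant a c * majorant b c ∂vol ≤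
      2304 * schurConst * (decay (gram x a) * decay (gram x b) * decay (gram a b)) ^ 2 := by
  calc _ ≤ ∫⁻ c, 64 * (decay (gram x a) * decay (gram x b) * decay (gram a b)) ^ 2 *
        (12 * (bump x c + bump a c + bump b c)) ∂vol :=
        lintegral_mono fun c => decay_mul_majorant_mul_majorant_le x a b c
    _ = 64 * (decay (gram x a) * decay (gram x b) * decay (gram a b)) ^ 2 *
        (12 * (∫⁻ c, bump x c ∂vol + ∫⁻ c, bump a c ∂vol + ∫⁻ c, bump b c ∂vol)) := by
        have hx := measurable_bump x
        have ha := measurable_bump a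
        have hb := measurable_bump b
        rw [lintegral_const_mul _ (by fun_prop), lintegral_const_mul _ (by fun_prop),
          lintegral_add_left (by fun_prop), lintegral_add_left hx]
    _ ≤ 64 * (decay (gram x a) * decay (gram x b) * decay (gram a b)) ^ 2 *
        (12 * (schurConst + schurConst + schurConst)) := by
        gcongr <;> exact lintegral_bump_le _
    _ = _ := by ring

/-- The square is what integration over c leaves behind; it lifts each decay exponent from 15 to 17.
The two singularities at b are then separated, and each term is a convolution covered by
`lintegral_sing_decay_le`. -/
theorem lintegral_triangle_le (x a : HypSpace) :
    ∫⁻ b, majorant x a * majorant x b * majorant a b *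
      (decay (gram x a) * decay (gram x b) * decay (gram a b)) ^ 2 ∂vol ≤
        2 * schurConst * bump x a := by
  have h1 : Measurable fun b =>
      sing (gram x b) ^ 2 * decay (gram x b) ^ 17 * decay (gram a b) ^ 16 :=
    (((measurable_const.sing_gram measurable_id).pow_const 2).mul
      ((measurable_const.decay_gram measurable_id).pow_const 17)).mul
      ((measurable_const.decay_gram measurable_id).pow_const 16)
  have h2 : Measurable fun b =>
      sing (gram a b) ^ 2 * decay (gram a b) ^ 17 * decay (gram x b) ^ 16 :=
    (((measurable_const.sing_gram measurable_id).pow_const 2).mul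
      ((measurable_const.decay_gram measurable_id).pow_const 17)).mul
      ((measurable_const.decay_gram measurable_id).pow_const 16)
  calc _ ≤ ∫⁻ b, sing (gram x a) * decay (gram x a) ^ 17 *
        (sing (gram x b) ^ 2 * decay (gram x b) ^ 17 * decay (gram a b) ^ 16 +
          sing (gram a b) ^ 2 * decay (gram a b) ^ 17 * decay (gram x b) ^ 16) ∂vol := by
        refine lintegral_mono fun b => ?_
        have hx1 := decay_le_one (one_le_gram x b)
        have ha1 := decay_le_one (one_le_gram a b)
        simp only [majorant]
        generalize decay (gram x a) = w
        generalize decay (gram x b) = wx at *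
        generalize decay (gram a b) = wa at *
        generalize sing (gram x a) = s
        generalize sing (gram x b) = sx
        generalize sing (gram a b) = sa
        calc w ^ 15 * s * (wx ^ 15 * sx) * (wa ^ 15 * sa) * (w * wx * wa) ^ 2
            = s * w ^ 17 * (sx * sa * (wx ^ 17 * wa ^ 17)) := by ring
          _ ≤ s * w ^ 17 * ((sx ^ 2 + sa ^ 2) * (wx ^ 17 * wa ^ 17)) := by
              gcongr
              exact ENNReal.mul_le_sq_add_sq sx sa
          -- The nonsingular weight gives up one factor to become exactly 1/cosh d.
          _ = s * w ^ 17 * (sx ^ 2 * wx ^ 17 * (wa ^ 16 * wa) +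
                sa ^ 2 * wa ^ 17 * (wx ^ 16 * wx)) := by ring
          _ ≤ s * w ^ 17 * (sx ^ 2 * wx ^ 17 * (wa ^ 16 * 1) +
                sa ^ 2 * wa ^ 17 * (wx ^ 16 * 1)) := by gcongr
          _ = _ := by ring
    _ = sing (gram x a) * decay (gram x a) ^ 17 *
        (∫⁻ b, sing (gram x b) ^ 2 * decay (gram x b) ^ 17 * decay (gram a b) ^ 16 ∂vol +
          ∫⁻ b, sing (gram a b) ^ 2 * decay (gram a b) ^ 17 * decay (gram x b) ^ 16 ∂vol) := by
        rw [lintegral_const_mul _ (by fun_prop), lintegral_add_left h1]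
    _ ≤ sing (gram x a) * decay (gram x a) ^ 17 *
        (schurConst * decay (gram x a) ^ 16 + schurConst * decay (gram a x) ^ 16) := by
        gcongr <;> exact lintegral_sing_decay_le _ _
    _ = 2 * schurConst * (sing (gram x a) * decay (gram x a) ^ 33) := by
        rw [gram_comm a x]
        ring
    _ ≤ _ := by
        rw [bump]
        gcongr
        exact le_self_pow (one_le_sing _) two_ne_zero

/-- The bound, uniform in the fixed vertex, for the integral of `tetraMajorant`. -/
def tetraConst : ENNReal := 4608 * schurConst ^ 3

theorem tetraConst_lt_top : tetraConst < ⊤ :=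
  ENNReal.mul_lt_top (by norm_num) (ENNReal.pow_lt_top schurConst_lt_top)

theorem lintegral_tetraMajorant_le (x : HypSpace) :
    ∫⁻ a, ∫⁻ b, ∫⁻ c, tetraMajorant x a b c ∂vol ∂vol ∂vol ≤ tetraConst := by
  calc _ ≤ ∫⁻ a, ∫⁻ b, 2304 * schurConst * (majorant x a * majorant x b * majorant a b *
        (decay (gram x a) * decay (gram x b) * decay (gram a b)) ^ 2) ∂vol ∂vol := by
        refine lintegral_mono fun a => lintegral_mono fun b => ?_
        have hm : Measurable fun c => decay (gram x c) ^ 15 * majorant a c * majorant b c :=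
          (((measurable_const.decay_gram measurable_id).pow_const 15).mul
            (measurable_const.majorant measurable_id)).mul
            (measurable_const.majorant measurable_id)
        simp only [tetraMajorant]
        rw [lintegral_const_mul _ hm]
        refine (mul_le_mul_right (lintegral_decay_mul_majorant_mul_majorant_le x a b) _).trans_eq ?_
        ring
    _ ≤ ∫⁻ a, 2304 * schurConst * (2 * schurConst * bump x a) ∂vol := by
        refine lintegral_mono fun a => ?_
        have hc : 2304 * schurConst ≠ ⊤ :=
          ENNReal.mul_ne_top (by norm_num) schurConst_lt_top.ne
        simp only
        rw [lintegral_const_mul' _ _ hc]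
        gcongr
        exact lintegral_triangle_le x a
    _ = 2304 * schurConst * (2 * schurConst * ∫⁻ a, bump x a ∂vol) := by
        rw [lintegral_const_mul _ ((measurable_bump x).const_mul _),
          lintegral_const_mul _ (measurable_bump x)]
    _ ≤ 2304 * schurConst * (2 * schurConst * schurConst) := by
        gcongr
        exact lintegral_bump_le x
    _ = _ := by rw [tetraConst]; ring

/-! ### The majorant with any of the three integrated vertices as c -/

theorem lintegral_tetraVol {f : HypSpace × HypSpace × HypSpace → ENNReal} (hf : Measurable f) :
    ∫⁻ p, f p ∂tetraVol = ∫⁻ a, ∫⁻ b, ∫⁻ c, f (a, b, c) ∂vol ∂vol ∂vol := by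
  rw [tetraVol, lintegral_prod _ hf.aemeasurable]
  refine lintegral_congr fun a => ?_
  rw [lintegral_prod _ (show Measurable fun q => f (a, q) from
    hf.comp measurable_prodMk_left).aemeasurable]

theorem lintegral_tetraMajorant_last_le (x : HypSpace) :
    ∫⁻ p, tetraMajorant x p.1 p.2.1 p.2.2 ∂tetraVol ≤ tetraConst := by
  rw [lintegral_tetraVol (measurable_const.tetraMajorant (by fun_prop) (by fun_prop)
    (by fun_prop))]
  exact lintegral_tetraMajorant_le x

theorem lintegral_tetraMajorant_middle_le (x : HypSpace) :
    ∫⁻ p, tetraMajorant x p.1 p.2.2 p.2.1 ∂tetraVol ≤ tetraConst := by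
  rw [lintegral_tetraVol (measurable_const.tetraMajorant (by fun_prop) (by fun_prop)
    (by fun_prop))]
  refine le_of_eq_of_le (lintegral_congr fun a => ?_) (lintegral_tetraMajorant_le x)
  exact lintegral_lintegral_swap (measurable_const.tetraMajorant measurable_const
    measurable_snd measurable_fst).aemeasurable

theorem lintegral_tetraMajorant_first_le (x : HypSpace) :
    ∫⁻ p, tetraMajorant x p.2.1 p.2.2 p.1 ∂tetraVol ≤ tetraConst := by
  have hm : Measurable fun p : HypSpace × HypSpace × HypSpace =>
      tetraMajorant x p.2.1 p.2.2 p.1 :=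
    measurable_const.tetraMajorant (by fun_prop) (by fun_prop) (by fun_prop)
  refine le_of_eq_of_le ?_ (lintegral_tetraMajorant_le x)
  rw [tetraVol, lintegral_prod_symm _ hm.aemeasurable, lintegral_prod]
  exact (hm.lintegral_prod_left').aemeasurable

/-! ### Bounds on the kernel -/

theorem measurable_kernel (ρ : ℝ) : Measurable fun p : HypSpace × HypSpace => kernel ρ p.1 p.2 := by
  have hd : Measurable fun p : HypSpace × HypSpace => hdist p.1 p.2 := by
    have := measurable_gram
    simp only [hdist_eq, Real.arcosh]
    fun_prop
  unfold kernel
  refine Measurable.ite (hd (measurableSet_singleton 0)) measurable_const ?_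
  split_ifs <;> fun_prop

theorem _root_.Measurable.kernel {α : Type*} [MeasurableSpace α] (ρ : ℝ) {f g : α → HypSpace}
    (hf : Measurable f) (hg : Measurable g) : Measurable fun a => kernel ρ (f a) (g a) :=
  (measurable_kernel ρ).comp (hf.prodMk hg)

theorem hdist_pos_of_ne {x y : HypSpace} (h : hdist x y ≠ 0) : 0 < hdist x y :=
  (Real.arcosh_nonneg (one_le_gram x y)).lt_of_ne' h

theorem cosh_hdist (x y : HypSpace) : Real.cosh (hdist x y) = gram x y :=
  Real.cosh_arcosh (one_le_gram x y)

theorem abs_kernel_le_div_sinh {ρ : ℝ} (hρ : 0 ≤ ρ) {x y : HypSpace} (h : hdist x y ≠ 0) :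
    |kernel ρ x y| ≤ hdist x y / Real.sinh (hdist x y) := by
  have hd := hdist_pos_of_ne h
  have hs := Real.sinh_pos_iff.2 hd
  rw [kernel, if_neg h]
  split_ifs with h0
  · rw [abs_of_pos (by positivity)]
  · have hρ' : 0 < ρ := hρ.lt_of_ne' h0
    rw [abs_div, abs_of_pos (mul_pos hρ' hs), div_le_div_iff₀ (mul_pos hρ' hs) hs]
    have := Real.abs_sin_le_abs (x := ρ * hdist x y)
    rw [abs_of_pos (mul_pos hρ' hd)] at this
    nlinarith

/-- The numerator grows only like log(2u), which costs the power u^(1/16); this is why the decay is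
15/16 rather than 1. -/
theorem self_div_sinh_le {d : ℝ} (hd : 0 < d) :
    d / Real.sinh d ≤ 64 * Real.cosh d ^ (-(15 / 16) : ℝ) := by
  have hs := Real.sinh_pos_iff.2 hd
  have hu := Real.one_le_cosh d
  have hsq := Real.cosh_sq d
  obtain ⟨u, hu'⟩ : ∃ u, u = Real.cosh d := ⟨_, rfl⟩
  rw [← hu'] at hu hsq ⊢
  have hu0 : 0 < u := by linarith
  rcases le_total u 2 with h | h
  · have h1 : d / Real.sinh d ≤ 1 := (div_le_one hs).2 (Real.self_le_sinh_iff.2 hd.le)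
    have h2 : (1 : ℝ) / 2 ≤ u ^ (-(15 / 16) : ℝ) := by
      calc (1 : ℝ) / 2 = 2 ^ (-1 : ℝ) := by rw [Real.rpow_neg_one]; norm_num
        _ ≤ 2 ^ (-(15 / 16) : ℝ) :=
            Real.rpow_le_rpow_of_exponent_le one_le_two (by norm_num)
        _ ≤ _ := Real.rpow_le_rpow_of_nonpos hu0 h (by norm_num)
    linarith
  · have h1 : u / 2 ≤ Real.sinh d := by nlinarith
    have h2 : d ≤ 32 * u ^ (1 / 16 : ℝ) := by
      calc d = Real.log (Real.exp d) := (Real.log_exp d).symm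
        _ ≤ Real.log (2 * u) := by
            refine Real.log_le_log (Real.exp_pos d) ?_
            rw [hu', Real.cosh_eq]
            linarith [Real.exp_pos (-d)]
        _ ≤ (2 * u) ^ (1 / 16 : ℝ) / (1 / 16) :=
            Real.log_le_rpow_div (by positivity) (by norm_num)
        _ = 16 * (2 ^ (1 / 16 : ℝ) * u ^ (1 / 16 : ℝ)) := by
            rw [Real.mul_rpow zero_le_two hu0.le]; ring
        _ ≤ 16 * (2 ^ (1 : ℝ) * u ^ (1 / 16 : ℝ)) := by gcongr <;> norm_num
        _ = _ := by rw [Real.rpow_one]; ring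
    calc d / Real.sinh d ≤ 32 * u ^ (1 / 16 : ℝ) / (u / 2) := by gcongr
      _ = 64 * (u ^ (1 / 16 : ℝ) * u ^ (-1 : ℝ)) := by
          rw [Real.rpow_neg_one]; field_simp; norm_num
      _ = _ := by rw [← Real.rpow_add hu0]; norm_num

theorem enorm_kernel_le {ρ : ℝ} (hρ : 0 ≤ ρ) (x y : HypSpace) :
    ‖kernel ρ x y‖ₑ ≤ 64 * decay (gram x y) ^ 15 := by
  rw [decay_pow (gram_pos x y).le, ← ENNReal.ofReal_ofNat, ← ENNReal.ofReal_mul (by norm_num),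
    Real.enorm_eq_ofReal_abs]
  refine ENNReal.ofReal_le_ofReal ?_
  by_cases h : hdist x y = 0
  · have h1 : gram x y = 1 := by rw [← cosh_hdist, h, Real.cosh_zero]
    rw [kernel, if_pos h, h1]
    norm_num
  · refine (abs_kernel_le_div_sinh hρ h).trans ((self_div_sinh_le (hdist_pos_of_ne h)).trans_eq ?_)
    rw [cosh_hdist]
    norm_num

theorem enorm_kernel_le_majorant {ρ : ℝ} (hρ : 0 ≤ ρ) (x y : HypSpace) :
    ‖kernel ρ x y‖ₑ ≤ 64 * majorant x y :=
  (enorm_kernel_le hρ x y).trans (mul_le_mul_right (decay_pow_le_majorant x y) _)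

theorem enorm_kernel_le_inv_mul_majorant {ρ : ℝ} (hρ : 0 < ρ) (x y : HypSpace) :
    ‖kernel ρ x y‖ₑ ≤ ENNReal.ofReal (1 / ρ) * majorant x y := by
  have hg := one_le_gram x y
  by_cases h : hdist x y = 0
  · have h1 : gram x y = 1 := by rw [← cosh_hdist, h, Real.cosh_zero]
    -- On the diagonal the inverse of zero in `ENNReal` is ⊤, so the bound is trivial there.
    have h2 : majorant x y = ⊤ := by simp [majorant, h1, sing, decay]
    rw [h2, ENNReal.mul_top (ENNReal.ofReal_pos.2 (by positivity)).ne']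
    exact le_top
  have hd := hdist_pos_of_ne h
  have hs := Real.sinh_pos_iff.2 hd
  have hsq := Real.cosh_sq (hdist x y)
  rw [cosh_hdist] at hsq
  obtain ⟨u, hu⟩ : ∃ u, u = gram x y := ⟨_, rfl⟩
  rw [← hu] at hsq hg
  have hu1 : 1 < u := by nlinarith
  have hu0 : 0 < u := by linarith
  have hsing : sing u = ENNReal.ofReal √(1 + 1 / (u - 1)) := by
    refine (ENNReal.pow_right_strictMono two_ne_zero).injective ?_
    have : 0 < u - 1 := by linarith
    change sing u ^ 2 = _ ^ 2
    rw [sing_sq_of_one_lt hu1, ← ENNReal.ofReal_pow (Real.sqrt_nonneg _),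
      Real.sq_sqrt (by positivity)]
  rw [majorant, ← hu, hsing, decay_pow hu0.le, ← ENNReal.ofReal_mul (by positivity),
    ← ENNReal.ofReal_mul (by positivity), Real.enorm_eq_ofReal_abs]
  refine ENNReal.ofReal_le_ofReal ?_
  have h1 : |kernel ρ x y| ≤ 1 / ρ * (1 / Real.sinh (hdist x y)) := by
    rw [kernel, if_neg h, if_neg hρ.ne', abs_div, abs_of_pos (mul_pos hρ hs),
      one_div_mul_one_div]
    gcongr
    exact Real.abs_sin_le_one _
  refine h1.trans ?_
  have h2 : 1 / Real.sinh (hdist x y) ≤ u⁻¹ * √(1 + 1 / (u - 1)) := by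
    have h3 : 0 < u - 1 := by linarith
    have hsqrt := Real.sq_sqrt (show 0 ≤ 1 + 1 / (u - 1) by positivity)
    refine le_of_sq_le_sq ?_ (by positivity)
    rw [mul_pow, hsqrt, div_pow, eq_sub_of_add_eq hsq.symm]
    -- After squaring, the claim is u(u - 1) ≤ u² - 1 = sinh² d.
    have h4 : u⁻¹ ^ 2 * (1 + 1 / (u - 1)) = 1 / (u * (u - 1)) := by field_simp; ring
    rw [h4, one_pow]
    exact one_div_le_one_div_of_le (by positivity) (by nlinarith)
  gcongr
  refine h2.trans ?_
  gcongr
  rw [← Real.rpow_neg_one]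
  exact Real.rpow_le_rpow_of_exponent_le hu1.le (by norm_num)

theorem measurable_tetraIntegrand (ρ : Fin 4 → Fin 4 → ℝ) (x : HypSpace) :
    Measurable (tetraIntegrand ρ x) := by
  refine Measurable.mul (.mul (.mul (.mul (.mul ?_ ?_) ?_) ?_) ?_) ?_ <;>
    exact Measurable.kernel _ (by fun_prop) (by fun_prop)

theorem integrable_and_abs_integral_le {ρ : Fin 4 → Fin 4 → ℝ} {x : HypSpace}
    {T : HypSpace × HypSpace × HypSpace → ENNReal} {C : ℝ} (hC : 0 ≤ C)
    (hT : ∫⁻ p, T p ∂tetraVol ≤ tetraConst)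
    (h : ∀ p, ‖tetraIntegrand ρ x p‖ₑ ≤ 262144 * ENNReal.ofReal C * T p) :
    Integrable (tetraIntegrand ρ x) tetraVol ∧
      |tetraAmplitude ρ x| ≤ 262144 * C * tetraConst.toReal := by
  have hc : 262144 * ENNReal.ofReal C ≠ ⊤ := ENNReal.mul_ne_top (by norm_num) ENNReal.ofReal_ne_top
  have hle : ∫⁻ p, ‖tetraIntegrand ρ x p‖ₑ ∂tetraVol ≤
      262144 * ENNReal.ofReal C * tetraConst := by
    refine (lintegral_mono h).trans ?_
    rw [lintegral_const_mul' _ _ hc]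
    gcongr
  have htop : 262144 * ENNReal.ofReal C * tetraConst ≠ ⊤ :=
    ENNReal.mul_ne_top hc tetraConst_lt_top.ne
  refine ⟨⟨(measurable_tetraIntegrand ρ x).aestronglyMeasurable,
    hle.trans_lt htop.lt_top⟩, ?_⟩
  have h1 := (enorm_integral_le_lintegral_enorm (tetraIntegrand ρ x)).trans hle
  have h2 := ENNReal.toReal_mono htop h1
  rw [ENNReal.toReal_mul, ENNReal.toReal_mul, ENNReal.toReal_ofReal hC] at h2
  simpa [tetraAmplitude] using h2

end HypSpace

end

/-! ### The four triangles -/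

open HypSpace in
theorem mainTheorem5 :
    ∃ K : ℝ, ∀ (ρ : Fin 4 → Fin 4 → ℝ), (∀ i j : Fin 4, i < j → 0 ≤ ρ i j) →
      ∀ (i j k : Fin 4), i < j → j < k → ρ i j ≠ 0 → ρ i k ≠ 0 → ρ j k ≠ 0 →
        ∀ x₁ : HypSpace,
          Integrable (tetraIntegrand ρ x₁) tetraVol ∧
            |tetraAmplitude ρ x₁| ≤ K / (ρ i j * ρ i k * ρ j k) := by
  -- 262144 = 64³, one factor 64 for each edge outside the triangle.
  refine ⟨262144 * tetraConst.toReal, fun ρ hρ i j k hij hjk h1 h2 h3 x => ?_⟩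
  have hij' := (hρ i j hij).lt_of_ne' h1
  have hik' := (hρ i k (hij.trans hjk)).lt_of_ne' h2
  have hjk' := (hρ j k hjk).lt_of_ne' h3
  have hC : 0 ≤ 1 / ρ i j * (1 / ρ i k) * (1 / ρ j k) := by positivity
  have e : 262144 * tetraConst.toReal / (ρ i j * ρ i k * ρ j k) =
      262144 * (1 / ρ i j * (1 / ρ i k) * (1 / ρ j k)) * tetraConst.toReal := by
    field_simp
  rw [e]
  have hcases : (i = 0 ∧ j = 1 ∧ k = 2) ∨ (i = 0 ∧ j = 1 ∧ k = 3) ∨ (i = 0 ∧ j = 2 ∧ k = 3) ∨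
      (i = 1 ∧ j = 2 ∧ k = 3) := by
    clear * - hij hjk
    revert i j k
    decide
  rcases hcases with ⟨rfl, rfl, rfl⟩ | ⟨rfl, rfl, rfl⟩ | ⟨rfl, rfl, rfl⟩ | ⟨rfl, rfl, rfl⟩
  · refine integrable_and_abs_integral_le hC (lintegral_tetraMajorant_last_le x) fun p => ?_
    rw [tetraIntegrand, enorm_mul, enorm_mul, enorm_mul, enorm_mul, enorm_mul,
      ENNReal.ofReal_mul (by positivity), ENNReal.ofReal_mul (by positivity)]
    calc _ ≤ (ENNReal.ofReal (1 / ρ 0 1) * majorant x p.1) *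
        (ENNReal.ofReal (1 / ρ 0 2) * majorant x p.2.1) *
        (64 * decay (gram x p.2.2) ^ 15) *
        (ENNReal.ofReal (1 / ρ 1 2) * majorant p.1 p.2.1) *
        (64 * majorant p.1 p.2.2) *
        (64 * majorant p.2.1 p.2.2) := by
          gcongr
          · exact enorm_kernel_le_inv_mul_majorant hij' _ _
          · exact enorm_kernel_le_inv_mul_majorant hik' _ _
          · exact enorm_kernel_le (hρ 0 3 (by decide)) _ _
          · exact enorm_kernel_le_inv_mul_majorant hjk' _ _
          · exact enorm_kernel_le_majorant (hρ 1 3 (by decide)) _ _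
          · exact enorm_kernel_le_majorant (hρ 2 3 (by decide)) _ _
      _ = _ := by rw [tetraMajorant]; ring
  · refine integrable_and_abs_integral_le hC (lintegral_tetraMajorant_middle_le x) fun p => ?_
    rw [tetraIntegrand, enorm_mul, enorm_mul, enorm_mul, enorm_mul, enorm_mul,
      ENNReal.ofReal_mul (by positivity), ENNReal.ofReal_mul (by positivity)]
    calc _ ≤ (ENNReal.ofReal (1 / ρ 0 1) * majorant x p.1) *
        (64 * decay (gram x p.2.1) ^ 15) *
        (ENNReal.ofReal (1 / ρ 0 3) * majorant x p.2.2) *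
        (64 * majorant p.1 p.2.1) *
        (ENNReal.ofReal (1 / ρ 1 3) * majorant p.1 p.2.2) *
        (64 * majorant p.2.1 p.2.2) := by
          gcongr
          · exact enorm_kernel_le_inv_mul_majorant hij' _ _
          · exact enorm_kernel_le (hρ 0 2 (by decide)) _ _
          · exact enorm_kernel_le_inv_mul_majorant hik' _ _
          · exact enorm_kernel_le_majorant (hρ 1 2 (by decide)) _ _
          · exact enorm_kernel_le_inv_mul_majorant hjk' _ _
          · exact enorm_kernel_le_majorant (hρ 2 3 (by decide)) _ _
      _ = _ := by rw [tetraMajorant, majorant_comm p.2.2 p.2.1]; ring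
  · refine integrable_and_abs_integral_le hC (lintegral_tetraMajorant_first_le x) fun p => ?_
    rw [tetraIntegrand, enorm_mul, enorm_mul, enorm_mul, enorm_mul, enorm_mul,
      ENNReal.ofReal_mul (by positivity), ENNReal.ofReal_mul (by positivity)]
    calc _ ≤ (64 * decay (gram x p.1) ^ 15) *
        (ENNReal.ofReal (1 / ρ 0 2) * majorant x p.2.1) *
        (ENNReal.ofReal (1 / ρ 0 3) * majorant x p.2.2) *
        (64 * majorant p.1 p.2.1) *
        (64 * majorant p.1 p.2.2) *
        (ENNReal.ofReal (1 / ρ 2 3) * majorant p.2.1 p.2.2) := by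
          gcongr
          · exact enorm_kernel_le (hρ 0 1 (by decide)) _ _
          · exact enorm_kernel_le_inv_mul_majorant hij' _ _
          · exact enorm_kernel_le_inv_mul_majorant hik' _ _
          · exact enorm_kernel_le_majorant (hρ 1 2 (by decide)) _ _
          · exact enorm_kernel_le_majorant (hρ 1 3 (by decide)) _ _
          · exact enorm_kernel_le_inv_mul_majorant hjk' _ _
      _ = _ := by rw [tetraMajorant, majorant_comm p.2.1 p.1, majorant_comm p.2.2 p.1]; ring
  -- This triangle avoids the fixed vertex, so any of the three remaining edges could be the
  -- nonsingular one; the edge to `p.2.2` is taken.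
  · refine integrable_and_abs_integral_le hC (lintegral_tetraMajorant_last_le x) fun p => ?_
    rw [tetraIntegrand, enorm_mul, enorm_mul, enorm_mul, enorm_mul, enorm_mul,
      ENNReal.ofReal_mul (by positivity), ENNReal.ofReal_mul (by positivity)]
    calc _ ≤ (64 * majorant x p.1) *
        (64 * majorant x p.2.1) *
        (64 * decay (gram x p.2.2) ^ 15) *
        (ENNReal.ofReal (1 / ρ 1 2) * majorant p.1 p.2.1) *
        (ENNReal.ofReal (1 / ρ 1 3) * majorant p.1 p.2.2) *
        (ENNReal.ofReal (1 / ρ 2 3) * majorant p.2.1 p.2.2) := by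
          gcongr
          · exact enorm_kernel_le_majorant (hρ 0 1 (by decide)) _ _
          · exact enorm_kernel_le_majorant (hρ 0 2 (by decide)) _ _
          · exact enorm_kernel_le (hρ 0 3 (by decide)) _ _
          · exact enorm_kernel_le_inv_mul_majorant hij' _ _
          · exact enorm_kernel_le_inv_mul_majorant hik' _ _
          · exact enorm_kernel_le_inv_mul_majorant hjk' _ _
      _ = _ := by rw [tetraMajorant]; ring
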